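/- Let $j\ge 1$ be an integer and let $\omega$ be a real number with $\omega\notin\{0,-2,-4,\dots,-2(j-2)\}$ (no condition if $j=1$). For $n\ge1$ let $\mathcal{B}r_n=\mathcal{B}r_n(\omega)$ be the Brauer algebra, i.e. the unital associative $\mathbb{C}$-algebra with generators $\sigma_i,\kappa_i$ ($1\le i\le n-1$) and defining relations $$\sigma_i^2=1,\quad \kappa_i^2=\omega\kappa_i,\quad \sigma_i\kappa_i=\kappa_i\sigma_i=\kappa_i,$$ $$\sigma_i\sigma_\ell=\sigma_\ell\sigma_i,\quad \kappa_i\kappa_\ell=\kappa_\ell\kappa_i,\quad \sigma_i\kappa_\ell=\kappa_\ell\sigma_i\qquad(|i-\ell|>1),$$ $$\sigma_i\sigma_{i+1}\sigma_i=\sigma_{i+1}\sigma_i\sigma_{i+1},\quad \kappa_i\kappa_{i+1}\kappa_i=\kappa_i,\quad \kappa_{i+1}\kappa_i\kappa_{i+1}=\kappa_{i+1},$$ $$\sigma_i\kappa_{i+1}\kappa_i=\sigma_{i+1}\kappa_i,\quad \kappa_{i+1}\kappa_i\sigma_{i+1}=\kappa_{i+1}\sigma_i\qquad(1\le i\le n-2).$$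 Elements of $\mathcal{B}r_{n-1}$ are regarded as elements of $\mathcal{B}r_n$ through $\sigma_i\mapsto\sigma_i$, $\kappa_i\mapsto\kappa_i$. Put $$\hat R_i(w)=\sigma_i\Bigl(1-\frac{\sigma_i}{w}+\frac{\kappa_i}{w-\varkappa}\Bigr),\qquad \varkappa=\frac{\omega}{2}-1,$$ and define $\Xi_1=1$ and $\Xi_n=\Xi_{n-1}\,\hat R_{n-1}(-(n-1))\cdots\hat R_2(-2)\hat R_1(-1)\in\mathcal{B}r_n$ for $2\le n\le j$. For $1\le k<m\le j$ let $\sigma_{k,m}=\sigma_{m-1}\cdots\sigma_{k+1}\sigma_k\sigma_{k+1}\cdots\sigma_{m-1}$ and $\kappa_{k,m}=\sigma_{m-1}\cdots\sigma_{k+1}\kappa_k\sigma_{k+1}\cdots\sigma_{m-1}$, let $y_m=\sum_{k=1}^{m-1}(\sigma_{k,m}-\kappa_{k,m})\in\mathcal{B}r_j$ be the Jucys–Murphy elements, and let $$E_{T_{\{[j];j\}}}=\frac{(y_2+1)\cdots(y_j+1)}{j!}\cdot\frac{(y_2+\omega-1)(y_3+\omega)\cdots(y_j+\omega+j-3)}{\omega(\omega+2)\cdots(\omega+2j-4)}$$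 be the complete symmetrizer of $\mathcal{B}r_j$ (empty products are $1$). Then: 1. For $j\ge2$ the two forms of the recurrence agree: $\Xi_j=\Xi_{j-1}\,\hat R_{j-1}(-(j-1))\cdots\hat R_1(-1)=\hat R_1(-1)\hat R_2(-2)\cdots\hat R_{j-1}(-(j-1))\,\Xi_{j-1}$. 2. $\displaystyle \Xi_j=\prod_{k=1}^{j-1}\bigl(\hat R_{j-1}(-1)\,\hat R_{j-2}(-2)\cdots\hat R_k(k-j)\bigr)$, where in the $k$-th bracket the factors are $\hat R_\ell(\ell-j)$ with $\ell$ descending from $j-1$ to $k$, and the brackets are multiplied from left to right in the order $k=1,2,\dots,j-1$. 3. $\sigma_r\Xi_j=\Xi_j\sigma_r=\Xi_j$ and $\kappa_r\Xi_j=\Xi_j\kappa_r=0$ for all $r=1,\dots,j-1$. 4. $\Xi_j^2=j!\,\Xi_j$ and $E_{T_{\{[j];j\}}}=\dfrac{1}{j!}\,\Xi_j$. -/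

import Mathlib

noncomputable section

namespace Brauer

/-- The indices `1, …, j - 1` of the generators of the Brauer algebra on `j` strands. -/
abbrev Idx (j : ℕ) : Type := {i : ℕ // 1 ≤ i ∧ i < j}

/-- The generators: `Gen.s i` stands for `σ_i` and `Gen.k i` for `κ_i`. -/
inductive Gen (j : ℕ) : Type
  | s (i : Idx j) : Gen j
  | k (i : Idx j) : Gen j

/-- `σ_i` in the free algebra. -/
def fs {j : ℕ} (i : Idx j) : FreeAlgebra ℂ (Gen j) := FreeAlgebra.ι ℂ (Gen.s i)

/-- `κ_i` in the free algebra. -/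
def fk {j : ℕ} (i : Idx j) : FreeAlgebra ℂ (Gen j) := FreeAlgebra.ι ℂ (Gen.k i)

/-- Indices with `|i - l| > 1`. -/
def Far {j : ℕ} (i l : Idx j) : Prop := i.1 + 1 < l.1 ∨ l.1 + 1 < i.1

/-- `Next i l` says that `l = i + 1`. -/
def Next {j : ℕ} (i l : Idx j) : Prop := l.1 = i.1 + 1

/-- The defining relations of the Brauer algebra. -/
inductive Rel (j : ℕ) (ω : ℂ) : FreeAlgebra ℂ (Gen j) → FreeAlgebra ℂ (Gen j) → Prop
  | s_sq (i : Idx j) : Rel j ω (fs i * fs i) 1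
  | k_sq (i : Idx j) : Rel j ω (fk i * fk i) (ω • fk i)
  | s_k (i : Idx j) : Rel j ω (fs i * fk i) (fk i)
  | k_s (i : Idx j) : Rel j ω (fk i * fs i) (fk i)
  | s_s_far (i l : Idx j) (h : Far i l) : Rel j ω (fs i * fs l) (fs l * fs i)
  | k_k_far (i l : Idx j) (h : Far i l) : Rel j ω (fk i * fk l) (fk l * fk i)
  | s_k_far (i l : Idx j) (h : Far i l) : Rel j ω (fs i * fk l) (fk l * fs i)
  | braid (i l : Idx j) (h : Next i l) : Rel j ω (fs i * fs l * fs i) (fs l * fs i * fs l)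
  | k_k_k (i l : Idx j) (h : Next i l) : Rel j ω (fk i * fk l * fk i) (fk i)
  | k_k_k' (i l : Idx j) (h : Next i l) : Rel j ω (fk l * fk i * fk l) (fk l)
  | s_k_k (i l : Idx j) (h : Next i l) : Rel j ω (fs i * fk l * fk i) (fs l * fk i)
  | k_k_s (i l : Idx j) (h : Next i l) : Rel j ω (fk l * fk i * fs l) (fk l * fs i)

end Brauer

open Brauer in
/-- The Brauer algebra on `j` strands with parameter `ω`: the unital associative complex algebra
given by the generators `σ_i`, `κ_i` (`1 ≤ i ≤ j - 1`) and the defining relations. -/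
def BrauerAlgebra (j : ℕ) (ω : ℂ) : Type := RingQuot (Rel j ω)

namespace Brauer

instance instRing (j : ℕ) (ω : ℂ) : Ring (BrauerAlgebra j ω) :=
  inferInstanceAs (Ring (RingQuot (Rel j ω)))

instance instAlgebra (j : ℕ) (ω : ℂ) : Algebra ℂ (BrauerAlgebra j ω) :=
  inferInstanceAs (Algebra ℂ (RingQuot (Rel j ω)))

/-- The quotient map from the free algebra. -/
def mk (j : ℕ) (ω : ℂ) : FreeAlgebra ℂ (Gen j) →ₐ[ℂ] BrauerAlgebra j ω :=
  RingQuot.mkAlgHom ℂ (Rel j ω)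

theorem mk_rel {j : ℕ} {ω : ℂ} {a b : FreeAlgebra ℂ (Gen j)} (h : Rel j ω a b) :
    mk j ω a = mk j ω b :=
  RingQuot.mkAlgHom_rel ℂ h

/-- The generator `σ_i` of the Brauer algebra on `j` strands; the value for `i` outside
`1, …, j - 1` is irrelevant and set to `0`. -/
def σ (j : ℕ) (ω : ℂ) (i : ℕ) : BrauerAlgebra j ω :=
  if h : 1 ≤ i ∧ i < j then mk j ω (fs ⟨i, h⟩) else 0

/-- The generator `κ_i` of the Brauer algebra on `j` strands; the value for `i` outside
`1, …, j - 1` is irrelevant and set to `0`. -/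
def κ (j : ℕ) (ω : ℂ) (i : ℕ) : BrauerAlgebra j ω :=
  if h : 1 ≤ i ∧ i < j then mk j ω (fk ⟨i, h⟩) else 0

/-- The inclusion of indices for `m ≤ n`. -/
def idxEmb {m n : ℕ} (h : m ≤ n) (i : Idx m) : Idx n := ⟨i.1, i.2.1, lt_of_lt_of_le i.2.2 h⟩

/-- The images of the generators under the natural map for `m ≤ n`. -/
def genEmb {m n : ℕ} (h : m ≤ n) (ω : ℂ) : Gen m → BrauerAlgebra n ω
  | Gen.s i => mk n ω (fs (idxEmb h i))
  | Gen.k i => mk n ω (fk (idxEmb h i))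

theorem lift_fs {m n : ℕ} (h : m ≤ n) (ω : ℂ) (i : Idx m) :
    FreeAlgebra.lift ℂ (genEmb h ω) (fs i) = mk n ω (fs (idxEmb h i)) := by
  simp [fs, genEmb]

theorem lift_fk {m n : ℕ} (h : m ≤ n) (ω : ℂ) (i : Idx m) :
    FreeAlgebra.lift ℂ (genEmb h ω) (fk i) = mk n ω (fk (idxEmb h i)) := by
  simp [fk, genEmb]

theorem lift_rel {m n : ℕ} (h : m ≤ n) (ω : ℂ) ⦃a b : FreeAlgebra ℂ (Gen m)⦄
    (r : Rel m ω a b) :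
    FreeAlgebra.lift ℂ (genEmb h ω) a = FreeAlgebra.lift ℂ (genEmb h ω) b := by
  cases r <;>
    simp only [map_mul, map_smul, map_one, lift_fs, lift_fk] <;>
    simp only [← map_mul, ← map_smul] <;>
    first
    | (rw [← map_one (mk n ω)]; exact mk_rel (Rel.s_sq _))
    | exact mk_rel (Rel.k_sq _)
    | exact mk_rel (Rel.s_k _)
    | exact mk_rel (Rel.k_s _)
    | exact mk_rel (Rel.s_s_far _ _ (by assumption))
    | exact mk_rel (Rel.k_k_far _ _ (by assumption))
    | exact mk_rel (Rel.s_k_far _ _ (by assumption))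
    | exact mk_rel (Rel.braid _ _ (by assumption))
    | exact mk_rel (Rel.k_k_k _ _ (by assumption))
    | exact mk_rel (Rel.k_k_k' _ _ (by assumption))
    | exact mk_rel (Rel.s_k_k _ _ (by assumption))
    | exact mk_rel (Rel.k_k_s _ _ (by assumption))

/-- The natural homomorphism from the Brauer algebra on `m` strands to the one on `n ≥ m` strands,
`σ_i ↦ σ_i`, `κ_i ↦ κ_i`, by which elements of the former are regarded as elements of the
latter. -/
def emb {m n : ℕ} (h : m ≤ n) (ω : ℂ) : BrauerAlgebra m ω →ₐ[ℂ] BrauerAlgebra n ω :=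
  RingQuot.liftAlgHom ℂ ⟨FreeAlgebra.lift ℂ (genEmb h ω), lift_rel h ω⟩

/-- The ascending ordered product `f a * f (a + 1) * ⋯ * f b`; it is `1` if `b < a`. -/
def prodUp {A : Type*} [Monoid A] (a b : ℕ) (f : ℕ → A) : A :=
  ((List.range' a (b + 1 - a)).map f).prod

/-- The descending ordered product `f b * f (b - 1) * ⋯ * f a`; it is `1` if `b < a`. -/
def prodDown {A : Type*} [Monoid A] (b a : ℕ) (f : ℕ → A) : A :=
  ((List.range' a (b + 1 - a)).reverse.map f).prod

/-- The R-matrix `R̂_i(w) = σ_i (1 - σ_i / w + κ_i / (w - ϰ))` with `ϰ = ω / 2 - 1`. -/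
def RHat (j : ℕ) (ω : ℂ) (i : ℕ) (w : ℂ) : BrauerAlgebra j ω :=
  σ j ω i * (1 - (1 / w) • σ j ω i + (1 / (w - (ω / 2 - 1))) • κ j ω i)

/-- `Ξ_1 = 1` and `Ξ_j = Ξ_{j-1} * (R̂_{j-1}(-(j-1)) ⋯ R̂_2(-2) R̂_1(-1))`; the value at `j = 0`
is irrelevant. -/
def Ξ (ω : ℂ) : (j : ℕ) → BrauerAlgebra j ω
  | 0 => 1
  | 1 => 1
  | j + 2 => emb (Nat.le_succ (j + 1)) ω (Ξ ω (j + 1)) *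
      prodDown (j + 1) 1 (fun i => RHat (j + 2) ω i (-(i : ℂ)))

/-- `σ_{k,m} = σ_{m-1} ⋯ σ_{k+1} σ_k σ_{k+1} ⋯ σ_{m-1}`, for `1 ≤ k < m ≤ j`. -/
def σ₂ (j : ℕ) (ω : ℂ) (k m : ℕ) : BrauerAlgebra j ω :=
  prodDown (m - 1) (k + 1) (σ j ω) * σ j ω k * prodUp (k + 1) (m - 1) (σ j ω)

/-- `κ_{k,m} = σ_{m-1} ⋯ σ_{k+1} κ_k σ_{k+1} ⋯ σ_{m-1}`, for `1 ≤ k < m ≤ j`. -/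
def κ₂ (j : ℕ) (ω : ℂ) (k m : ℕ) : BrauerAlgebra j ω :=
  prodDown (m - 1) (k + 1) (σ j ω) * κ j ω k * prodUp (k + 1) (m - 1) (σ j ω)

/-- The Jucys-Murphy element `y_m = ∑_{k=1}^{m-1} (σ_{k,m} - κ_{k,m})`, for `1 ≤ m ≤ j`. -/
def y (j : ℕ) (ω : ℂ) (m : ℕ) : BrauerAlgebra j ω :=
  ∑ k ∈ Finset.Icc 1 (m - 1), (σ₂ j ω k m - κ₂ j ω k m)

/-- The complete symmetrizer of the Brauer algebra on `j` strands,
`(∏_{m=2}^{j} (y_m + 1) / j!) * (∏_{m=2}^{j} (y_m + ω + m - 3) / ∏_{m=2}^{j} (ω + 2 m - 4))`. -/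
def symmetrizer (j : ℕ) (ω : ℂ) : BrauerAlgebra j ω :=
  ((1 / (j.factorial : ℂ)) • prodUp 2 j (fun m => y j ω m + 1)) *
    ((1 / ∏ m ∈ Finset.Icc 2 j, (ω + 2 * (m : ℂ) - 4)) •
      prodUp 2 j (fun m => y j ω m + algebraMap ℂ (BrauerAlgebra j ω) (ω + (m : ℂ) - 3)))

end Brauer

end

/-! Everything is done in an arbitrary complex algebra containing elements `s i`, `k i` that satisfy
the Brauer relations. Call an element right (left) invariant if right (left) multiplication by every
`s i` fixes it and by every `k i` kills it. Any expression in the generators acts on invariants by a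
scalar, its augmentation, obtained by setting `s i = 1`, `k i = 0`. If `x` is right invariant, `y`
is left invariant and both have augmentation `c ≠ 0`, then `c • x = x * y = c • y`, so `x = y`
(`Aug.eq_of_inv`). Every identity of the theorem reduces to this kind of comparison.

Three expressions are compared. The fusion product `fusionR` is right invariant: by the Yang-Baxter
equation a factor `R_i(-1)` passes through `down n` and emerges on the right as `R_{i+1}(-1)`, which
absorbs `s (i + 1)` and kills `k (i + 1)` (`rInv_mul_down`). Reversing words makes `fusionL` left
invariant; reflecting indices, `i ↦ N - i`, does the same for the factorized form. All three have
augmentation `N!`, so they coincide, and `Ξ` is invariant on both sides with square `N! • Ξ`.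

The Jucys-Murphy product `jmProd` is also right invariant (`rInv_jmProd`): the factor `y_m + ω + m -
3` kills the new contraction, and `y_m + 1` then symmetrizes over the new strand. Comparing
augmentations identifies the symmetrizer with `Ξ / N!`. -/

noncomputable section

/-! ### Brauer relations, their symmetries, and the Yang-Baxter equation -/

namespace Brauer

open MulOpposite

variable {A : Type*} [Ring A] [Algebra ℂ A]

/-- Elements `s i`, `k i` (`1 ≤ i < N`) of an algebra that satisfy the relations of the Brauer
algebra on `N` strands, in a form symmetric under reversal of words and of indices. -/
structure IsBrauerFamily (N : ℕ) (ω : ℂ) (s k : ℕ → A) : Prop where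
  ss : ∀ i, 1 ≤ i → i < N → s i * s i = 1
  kk : ∀ i, 1 ≤ i → i < N → k i * k i = ω • k i
  sk : ∀ i, 1 ≤ i → i < N → s i * k i = k i
  ks : ∀ i, 1 ≤ i → i < N → k i * s i = k i
  far_ss : ∀ i l, 1 ≤ i → i + 1 < l → l < N → Commute (s i) (s l)
  far_kk : ∀ i l, 1 ≤ i → i + 1 < l → l < N → Commute (k i) (k l)
  far_sk : ∀ i l, 1 ≤ i → i + 1 < l → l < N → Commute (s i) (k l)
  far_ks : ∀ i l, 1 ≤ i → i + 1 < l → l < N → Commute (k i) (s l)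
  braid : ∀ i, 1 ≤ i → i + 1 < N → s i * s (i + 1) * s i = s (i + 1) * s i * s (i + 1)
  kkk : ∀ i, 1 ≤ i → i + 1 < N → k i * k (i + 1) * k i = k i
  kkk' : ∀ i, 1 ≤ i → i + 1 < N → k (i + 1) * k i * k (i + 1) = k (i + 1)
  skk : ∀ i, 1 ≤ i → i + 1 < N → s i * k (i + 1) * k i = s (i + 1) * k i
  skk' : ∀ i, 1 ≤ i → i + 1 < N → s (i + 1) * k i * k (i + 1) = s i * k (i + 1)
  kks : ∀ i, 1 ≤ i → i + 1 < N → k (i + 1) * k i * s (i + 1) = k (i + 1) * s i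
  kks' : ∀ i, 1 ≤ i → i + 1 < N → k i * k (i + 1) * s i = k i * s (i + 1)

/-- The R-matrix built on a pair of elements `s`, `k`. -/
def rMat (ω : ℂ) (s k : A) (w : ℂ) : A := s * (1 - (1 / w) • s + (1 / (w - (ω / 2 - 1))) • k)

theorem rMat_eq {ω : ℂ} {s k : A} (ss : s * s = 1) (sk : s * k = k) (w : ℂ) :
    rMat ω s k w = s - (1 / w) • (1 : A) + (1 / (w - (ω / 2 - 1))) • k := by
  simp [rMat, mul_add, mul_sub, ss, sk]

theorem op_rMat {ω : ℂ} {s k : A} (sk : s * k = k) (ks : k * s = k) (w : ℂ) :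
    op (rMat ω s k w) = rMat ω (op s) (op k) w := by
  simp [rMat, mul_add, mul_sub, sk, ← op_mul, ks]

namespace IsBrauerFamily

variable {N : ℕ} {ω : ℂ} {s k : ℕ → A}

theorem op (h : IsBrauerFamily N ω s k) :
    IsBrauerFamily N ω (fun i => op (s i)) (fun i => op (k i)) where
  ss i h1 h2 := by rw [← op_mul, h.ss i h1 h2, op_one]
  kk i h1 h2 := by rw [← op_mul, h.kk i h1 h2, op_smul]
  sk i h1 h2 := by rw [← op_mul, h.ks i h1 h2]
  ks i h1 h2 := by rw [← op_mul, h.sk i h1 h2]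
  far_ss i l h1 h2 h3 := (h.far_ss i l h1 h2 h3).op
  far_kk i l h1 h2 h3 := (h.far_kk i l h1 h2 h3).op
  far_sk i l h1 h2 h3 := (h.far_sk i l h1 h2 h3).op
  far_ks i l h1 h2 h3 := (h.far_ks i l h1 h2 h3).op
  braid i h1 h2 := by simp only [← op_mul, ← mul_assoc, h.braid i h1 h2]
  kkk i h1 h2 := by simp only [← op_mul, ← mul_assoc, h.kkk i h1 h2]
  kkk' i h1 h2 := by simp only [← op_mul, ← mul_assoc, h.kkk' i h1 h2]
  skk i h1 h2 := by simp only [← op_mul, ← mul_assoc, h.kks' i h1 h2]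
  skk' i h1 h2 := by simp only [← op_mul, ← mul_assoc, h.kks i h1 h2]
  kks i h1 h2 := by simp only [← op_mul, ← mul_assoc, h.skk' i h1 h2]
  kks' i h1 h2 := by simp only [← op_mul, ← mul_assoc, h.skk i h1 h2]

/-- Reflection exchanges the roles of `i` and `i + 1` in each local relation, so each primed field
is supplied by its unprimed partner and conversely. -/
theorem reflect (h : IsBrauerFamily N ω s k) :
    IsBrauerFamily N ω (fun i => s (N - i)) (fun i => k (N - i)) := by
  have e : ∀ i, 1 ≤ i → i + 1 < N → N - i = N - (i + 1) + 1 := fun i _ _ => by omega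
  exact {
    ss := fun i h1 h2 => h.ss _ (by omega) (by omega)
    kk := fun i h1 h2 => h.kk _ (by omega) (by omega)
    sk := fun i h1 h2 => h.sk _ (by omega) (by omega)
    ks := fun i h1 h2 => h.ks _ (by omega) (by omega)
    far_ss := fun i l h1 h2 h3 => (h.far_ss _ _ (by omega) (by omega) (by omega)).symm
    far_kk := fun i l h1 h2 h3 => (h.far_kk _ _ (by omega) (by omega) (by omega)).symm
    far_sk := fun i l h1 h2 h3 => (h.far_ks _ _ (by omega) (by omega) (by omega)).symm
    far_ks := fun i l h1 h2 h3 => (h.far_sk _ _ (by omega) (by omega) (by omega)).symm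
    braid := fun i h1 h2 => by
      rw [e i h1 h2]; exact (h.braid _ (by omega) (by omega)).symm
    kkk := fun i h1 h2 => by rw [e i h1 h2]; exact h.kkk' _ (by omega) (by omega)
    kkk' := fun i h1 h2 => by rw [e i h1 h2]; exact h.kkk _ (by omega) (by omega)
    skk := fun i h1 h2 => by rw [e i h1 h2]; exact h.skk' _ (by omega) (by omega)
    skk' := fun i h1 h2 => by rw [e i h1 h2]; exact h.skk _ (by omega) (by omega)
    kks := fun i h1 h2 => by rw [e i h1 h2]; exact h.kks' _ (by omega) (by omega)
    kks' := fun i h1 h2 => by rw [e i h1 h2]; exact h.kks _ (by omega) (by omega) }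

variable (h : IsBrauerFamily N ω s k) {i : ℕ} (h1 : 1 ≤ i) (h2 : i + 1 < N)
include h h1 h2

theorem ssk : s i * s (i + 1) * k i = k (i + 1) * k i := by
  rw [mul_assoc, ← h.skk i h1 h2, ← mul_assoc, ← mul_assoc, h.ss i h1 (by omega), one_mul]

theorem ssk' : s (i + 1) * s i * k (i + 1) = k i * k (i + 1) := by
  rw [mul_assoc, ← h.skk' i h1 h2, ← mul_assoc, ← mul_assoc, h.ss (i + 1) (by omega) h2, one_mul]

theorem kss : k i * s (i + 1) * s i = k i * k (i + 1) := by
  rw [← h.kks' i h1 h2, mul_assoc, h.ss i h1 (by omega), mul_one]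

theorem kss' : k (i + 1) * s i * s (i + 1) = k (i + 1) * k i := by
  rw [← h.kks i h1 h2, mul_assoc, h.ss (i + 1) (by omega) h2, mul_one]

theorem ksk : k i * s (i + 1) * k i = k i := by
  rw [mul_assoc, ← h.skk i h1 h2, mul_assoc, ← mul_assoc, h.ks i h1 (by omega), ← mul_assoc,
    h.kkk i h1 h2]

theorem ksk' : k (i + 1) * s i * k (i + 1) = k (i + 1) := by
  rw [mul_assoc, ← h.skk' i h1 h2, mul_assoc, ← mul_assoc, h.ks (i + 1) (by omega) h2,
    ← mul_assoc, h.kkk' i h1 h2]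

theorem sks : s (i + 1) * k i * s (i + 1) = s i * k (i + 1) * s i := by
  rw [← h.skk i h1 h2, mul_assoc, mul_assoc, ← mul_assoc (k (i + 1)), h.kks i h1 h2, mul_assoc]

/-- The Yang-Baxter equation. -/
theorem yangBaxter {u v : ℂ} (hu : u ≠ 0) (hv : v ≠ 0) (huv : u + v ≠ 0)
    (hu' : u - (ω / 2 - 1) ≠ 0) (hv' : v - (ω / 2 - 1) ≠ 0) (huv' : u + v - (ω / 2 - 1) ≠ 0) :
    rMat ω (s i) (k i) u * rMat ω (s (i + 1)) (k (i + 1)) (u + v) * rMat ω (s i) (k i) v =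
      rMat ω (s (i + 1)) (k (i + 1)) v * rMat ω (s i) (k i) (u + v) *
        rMat ω (s (i + 1)) (k (i + 1)) u := by
  have a := h.ss i h1 (by omega)
  have a' := h.ss (i + 1) (by omega) h2
  have b := h.sk i h1 (by omega)
  have b' := h.sk (i + 1) (by omega) h2
  simp only [rMat_eq a b, rMat_eq a' b']
  -- The relations bring every cubic word to a normal form; what remains is an identity of rational
  -- functions for each normal word.
  simp only [mul_add, add_mul, mul_sub, sub_mul, smul_mul_assoc, mul_smul_comm, mul_one, one_mul,
    h.braid i h1 h2, h.kkk i h1 h2, h.kkk' i h1 h2, h.skk i h1 h2, h.skk' i h1 h2,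
    h.kks i h1 h2, h.kks' i h1 h2, h.ssk h1 h2, h.ssk' h1 h2, h.kss h1 h2, h.kss' h1 h2,
    h.ksk h1 h2, h.ksk' h1 h2, h.sks h1 h2, a, a', b, b', h.ks i h1 (by omega),
    h.ks (i + 1) (by omega) h2, h.kk i h1 (by omega), h.kk (i + 1) (by omega) h2]
  generalize s i = S, s (i + 1) = T, k i = K, k (i + 1) = L
  clear h
  -- Taking `ϰ` as the free parameter turns the denominators into `u - t`, `v - t`, `u + v - t`.
  generalize ht : ω / 2 - 1 = t at *
  obtain rfl : ω = 2 * (t + 1) := by rw [← ht]; ring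
  match_scalars <;> field_simp <;> ring

end IsBrauerFamily
end Brauer
end

/-! ### Ordered products -/

noncomputable section

namespace Brauer

open MulOpposite


section Products

variable {M : Type*} [Monoid M]

theorem prodUp_of_lt {a b : ℕ} (h : b < a) (f : ℕ → M) : prodUp a b f = 1 := by
  simp [prodUp, Nat.sub_eq_zero_of_le (Nat.succ_le_of_lt h)]

theorem prodDown_of_lt {a b : ℕ} (h : b < a) (f : ℕ → M) : prodDown b a f = 1 := by
  simp [prodDown, Nat.sub_eq_zero_of_le (Nat.succ_le_of_lt h)]

theorem prodUp_succ {a b : ℕ} (h : a ≤ b + 1) (f : ℕ → M) :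
    prodUp a (b + 1) f = prodUp a b f * f (b + 1) := by
  rw [prodUp, show b + 1 + 1 - a = b + 1 - a + 1 by omega, List.range'_1_concat,
    show a + (b + 1 - a) = b + 1 by omega]
  simp [prodUp]

theorem prodDown_succ {a b : ℕ} (h : a ≤ b + 1) (f : ℕ → M) :
    prodDown (b + 1) a f = f (b + 1) * prodDown b a f := by
  rw [prodDown, show b + 1 + 1 - a = b + 1 - a + 1 by omega, List.range'_1_concat,
    show a + (b + 1 - a) = b + 1 by omega]
  simp [prodDown]

theorem prodUp_cons {a b : ℕ} (h : a ≤ b) (f : ℕ → M) :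
    prodUp a b f = f a * prodUp (a + 1) b f := by
  rw [prodUp, show b + 1 - a = b + 1 - (a + 1) + 1 by omega, List.range'_succ]
  simp [prodUp]

theorem prodDown_cons {a b : ℕ} (h : a ≤ b) (f : ℕ → M) :
    prodDown b a f = prodDown b (a + 1) f * f a := by
  rw [prodDown, show b + 1 - a = b + 1 - (a + 1) + 1 by omega, List.range'_succ]
  simp [prodDown]

theorem prodUp_congr {a b : ℕ} {f g : ℕ → M} (h : ∀ i, a ≤ i → i ≤ b → f i = g i) :
    prodUp a b f = prodUp a b g := by
  rw [prodUp, prodUp, List.map_congr_left]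
  intro i hi
  rw [List.mem_range'_1] at hi
  exact h i hi.1 (by omega)

theorem prodDown_congr {a b : ℕ} {f g : ℕ → M} (h : ∀ i, a ≤ i → i ≤ b → f i = g i) :
    prodDown b a f = prodDown b a g := by
  rw [prodDown, prodDown, List.map_congr_left]
  intro i hi
  rw [List.mem_reverse, List.mem_range'_1] at hi
  exact h i hi.1 (by omega)

theorem map_prodDown {M' F : Type*} [Monoid M'] [FunLike F M M'] [MonoidHomClass F M M'] (φ : F)
    (a b : ℕ) (f : ℕ → M) :
    φ (prodDown b a f) = prodDown b a (fun i => φ (f i)) := by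
  simp [prodDown, map_list_prod, Function.comp_def]

theorem op_prodUp (a b : ℕ) (f : ℕ → M) :
    op (prodUp a b f) = prodDown b a (fun i => op (f i)) := by
  simp [prodDown, prodUp, op_list_prod, Function.comp_def]

theorem commute_prodUp {x : M} {a b : ℕ} {f : ℕ → M}
    (h : ∀ i, a ≤ i → i ≤ b → Commute x (f i)) : Commute x (prodUp a b f) := by
  refine Commute.list_prod_right _ _ fun y hy => ?_
  obtain ⟨i, hi, rfl⟩ := List.mem_map.1 hy
  rw [List.mem_range'_1] at hi
  exact h i hi.1 (by omega)

theorem commute_prodDown {x : M} {a b : ℕ} {f : ℕ → M}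
    (h : ∀ i, a ≤ i → i ≤ b → Commute x (f i)) : Commute x (prodDown b a f) := by
  refine Commute.list_prod_right _ _ fun y hy => ?_
  obtain ⟨i, hi, rfl⟩ := List.mem_map.1 hy
  rw [List.mem_reverse, List.mem_range'_1] at hi
  exact h i hi.1 (by omega)

/-- Reversal of the indices turns descending products into ascending ones. -/
theorem prodDown_reflect (N a b : ℕ) (hb : b < N) (ha : 1 ≤ a) (f : ℕ → M) :
    prodDown b a f = prodUp (N - b) (N - a) (fun i => f (N - i)) := by
  induction b with
  | zero => rw [prodDown_of_lt (by omega), prodUp_of_lt (by omega)]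
  | succ b ih =>
    by_cases h : a ≤ b + 1
    · rw [prodDown_succ h, ih (by omega), prodUp_cons (by omega : N - (b + 1) ≤ N - a),
        show N - (N - (b + 1)) = b + 1 by omega, show N - (b + 1) + 1 = N - b by omega]
    · rw [prodDown_of_lt (by omega), prodUp_of_lt (by omega)]

theorem prodUp_reflect (N a b : ℕ) (hb : b < N) (ha : 1 ≤ a) (f : ℕ → M) :
    prodUp a b f = prodDown (N - a) (N - b) (fun i => f (N - i)) := by
  induction b with
  | zero => rw [prodDown_of_lt (by omega), prodUp_of_lt (by omega)]
  | succ b ih =>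
    by_cases h : a ≤ b + 1
    · rw [prodUp_succ h, ih (by omega), prodDown_cons (by omega : N - (b + 1) ≤ N - a),
        show N - (N - (b + 1)) = b + 1 by omega, show N - (b + 1) + 1 = N - b by omega]
    · rw [prodDown_of_lt (by omega), prodUp_of_lt (by omega)]

end Products

/-! ### Invariants and augmentations -/

variable {A : Type*} [Ring A]

/-- `x` is fixed by right multiplication with `s i` and annihilated by `k i`, for `1 ≤ i < N`. -/
def RInv (N : ℕ) (s k : ℕ → A) (x : A) : Prop :=
  ∀ i, 1 ≤ i → i < N → x * s i = x ∧ x * k i = 0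

/-- `x` is fixed by left multiplication with `s i` and annihilated by `k i`, for `1 ≤ i < N`. -/
def LInv (N : ℕ) (s k : ℕ → A) (x : A) : Prop :=
  ∀ i, 1 ≤ i → i < N → s i * x = x ∧ k i * x = 0

variable {N : ℕ} {s k : ℕ → A}

theorem lInv_of_op {x : A} (h : RInv N (fun i => op (s i)) (fun i => op (k i)) (op x)) :
    LInv N s k x := fun i h1 h2 => by
  have := h i h1 h2
  simp only [← op_mul, op_inj] at this
  exact ⟨this.1, op_injective (by simpa using this.2)⟩

theorem RInv.mono {x : A} (h : RInv N s k x) {M : ℕ} (hM : M ≤ N) : RInv M s k x :=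
  fun i h1 h2 => h i h1 (by omega)

variable [Algebra ℂ A] {ω : ℂ}

/-- `x` acts as the scalar `c` on all right and left invariants. -/
def Aug (N : ℕ) (s k : ℕ → A) (x : A) (c : ℂ) : Prop :=
  (∀ z, RInv N s k z → z * x = c • z) ∧ ∀ z, LInv N s k z → x * z = c • z

namespace Aug

theorem one : Aug N s k 1 1 := by simp [Aug]

theorem algebraMap (c : ℂ) : Aug N s k (algebraMap ℂ A c) c :=
  ⟨fun z _ => by rw [← Algebra.commutes, Algebra.smul_def], fun z _ => by rw [Algebra.smul_def]⟩

theorem gen_s {i : ℕ} (h1 : 1 ≤ i) (h2 : i < N) : Aug N s k (s i) 1 :=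
  ⟨fun _ h => by simp [(h i h1 h2).1], fun _ h => by simp [(h i h1 h2).1]⟩

theorem gen_k {i : ℕ} (h1 : 1 ≤ i) (h2 : i < N) : Aug N s k (k i) 0 :=
  ⟨fun _ h => by simp [(h i h1 h2).2], fun _ h => by simp [(h i h1 h2).2]⟩

variable {x y : A} {c d : ℂ}

theorem mul (hx : Aug N s k x c) (hy : Aug N s k y d) : Aug N s k (x * y) (c * d) :=
  ⟨fun z h => by rw [← mul_assoc, hx.1 z h, smul_mul_assoc, hy.1 z h, smul_smul],
    fun z h => by rw [mul_assoc, hy.2 z h, mul_smul_comm, hx.2 z h, smul_smul, mul_comm]⟩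

theorem add (hx : Aug N s k x c) (hy : Aug N s k y d) : Aug N s k (x + y) (c + d) :=
  ⟨fun z h => by rw [mul_add, hx.1 z h, hy.1 z h, add_smul],
    fun z h => by rw [add_mul, hx.2 z h, hy.2 z h, add_smul]⟩

theorem smul (a : ℂ) (hx : Aug N s k x c) : Aug N s k (a • x) (a * c) :=
  ⟨fun z h => by rw [mul_smul_comm, hx.1 z h, smul_smul],
    fun z h => by rw [smul_mul_assoc, hx.2 z h, smul_smul]⟩

theorem sub (hx : Aug N s k x c) (hy : Aug N s k y d) : Aug N s k (x - y) (c - d) :=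
  ⟨fun z h => by rw [mul_sub, hx.1 z h, hy.1 z h, sub_smul],
    fun z h => by rw [sub_mul, hx.2 z h, hy.2 z h, sub_smul]⟩

theorem prodUp {f : ℕ → A} {g : ℕ → ℂ} {a b : ℕ}
    (h : ∀ i, a ≤ i → i ≤ b → Aug N s k (f i) (g i)) :
    Aug N s k (prodUp a b f) (∏ i ∈ Finset.Icc a b, g i) := by
  induction b with
  | zero =>
    rcases a with _ | a
    · simpa [Brauer.prodUp] using h 0 le_rfl le_rfl
    · simpa [Brauer.prodUp] using one
  | succ b ih =>
    by_cases hab : a ≤ b + 1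
    · rw [prodUp_succ hab, Finset.prod_Icc_succ_top hab]
      exact (ih fun i h1 h2 => h i h1 (by omega)).mul (h _ hab le_rfl)
    · rw [prodUp_of_lt (by omega), Finset.Icc_eq_empty (by omega), Finset.prod_empty]
      exact one

theorem prodDown {f : ℕ → A} {g : ℕ → ℂ} {a b : ℕ}
    (h : ∀ i, a ≤ i → i ≤ b → Aug N s k (f i) (g i)) :
    Aug N s k (prodDown b a f) (∏ i ∈ Finset.Icc a b, g i) := by
  induction b with
  | zero =>
    rcases a with _ | a
    · simpa [Brauer.prodDown] using h 0 le_rfl le_rfl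
    · simpa [Brauer.prodDown] using one
  | succ b ih =>
    by_cases hab : a ≤ b + 1
    · rw [prodDown_succ hab, Finset.prod_Icc_succ_top hab, mul_comm]
      exact (h _ hab le_rfl).mul (ih fun i h1 h2 => h i h1 (by omega))
    · rw [prodDown_of_lt (by omega), Finset.Icc_eq_empty (by omega), Finset.prod_empty]
      exact one

theorem rMat {i : ℕ} (h1 : 1 ≤ i) (h2 : i < N) (w : ℂ) :
    Aug N s k (rMat ω (s i) (k i) w) (1 - 1 / w) := by
  have := (gen_s (s := s) (k := k) h1 h2).mul
    ((one.sub ((gen_s h1 h2).smul (1 / w))).add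
      ((gen_k (s := s) (k := k) h1 h2).smul (1 / (w - (ω / 2 - 1)))))
  simpa [Brauer.rMat] using this

/-- A right and a left invariant with the same nonzero augmentation coincide. -/
theorem eq_of_inv (hx : Aug N s k x c) (hy : Aug N s k y c) (hc : c ≠ 0) (hr : RInv N s k x)
    (hl : LInv N s k y) : x = y := by
  have h := (hy.1 x hr).symm.trans (hx.2 y hl)
  exact smul_right_injective A hc h

end Aug

/-! ### Fusion products and their invariance -/

/-- `R_n(-n) ⋯ R_2(-2) R_1(-1)`. -/
def down (ω : ℂ) (s k : ℕ → A) (n : ℕ) : A :=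
  prodDown n 1 (fun i => rMat ω (s i) (k i) (-(i : ℂ)))

/-- `R_1(-1) R_2(-2) ⋯ R_n(-n)`. -/
def up (ω : ℂ) (s k : ℕ → A) (n : ℕ) : A :=
  prodUp 1 n (fun i => rMat ω (s i) (k i) (-(i : ℂ)))

/-- `down 0 * down 1 * ⋯ * down (n - 1)`. -/
def fusionR (ω : ℂ) (s k : ℕ → A) : ℕ → A
  | 0 => 1
  | n + 1 => fusionR ω s k n * down ω s k n

/-- `up (n - 1) * ⋯ * up 1 * up 0`. -/
def fusionL (ω : ℂ) (s k : ℕ → A) : ℕ → A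
  | 0 => 1
  | n + 1 => up ω s k n * fusionL ω s k n

theorem op_fusionL (h : IsBrauerFamily N ω s k) {n : ℕ} (hn : n ≤ N) :
    op (fusionL ω s k n) = fusionR ω (fun i => op (s i)) (fun i => op (k i)) n := by
  induction n with
  | zero => rfl
  | succ n ih =>
    rw [fusionL, op_mul, ih (by omega), fusionR]
    congr 1
    rw [up, down, op_prodUp]
    exact prodDown_congr fun i h1 h2 =>
      op_rMat (h.sk i h1 (by omega)) (h.ks i h1 (by omega)) _

/-- The product telescopes, its factors being `(i + 1) / i`; it is the common augmentation of `down
n` and `up n`. -/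
theorem aug_prod_one_sub (n : ℕ) : ∏ i ∈ Finset.Icc 1 n, (1 - 1 / -(i : ℂ)) = (n : ℂ) + 1 := by
  induction n with
  | zero => simp
  | succ n ih =>
    rw [Finset.prod_Icc_succ_top (by omega), ih]
    have : (n : ℂ) + 1 ≠ 0 := by exact_mod_cast n.succ_ne_zero
    push_cast
    field_simp
    ring

theorem aug_down {n : ℕ} (hn : n < N) : Aug N s k (down ω s k n) (n + 1) := by
  rw [← aug_prod_one_sub]
  exact Aug.prodDown fun i h1 h2 => Aug.rMat h1 (by omega) _

theorem aug_up {n : ℕ} (hn : n < N) : Aug N s k (up ω s k n) (n + 1) := by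
  rw [← aug_prod_one_sub]
  exact Aug.prodUp fun i h1 h2 => Aug.rMat h1 (by omega) _

theorem aug_fusionR {n : ℕ} (hn : n ≤ N) : Aug N s k (fusionR ω s k n) n.factorial := by
  induction n with
  | zero => simpa [fusionR] using Aug.one
  | succ n ih =>
    have := (ih (by omega)).mul (aug_down (ω := ω) (s := s) (k := k) (n := n) (N := N) hn)
    rw [Nat.factorial_succ, mul_comm]
    exact_mod_cast this

theorem aug_fusionL {n : ℕ} (hn : n ≤ N) : Aug N s k (fusionL ω s k n) n.factorial := by
  induction n with
  | zero => simpa [fusionL] using Aug.one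
  | succ n ih =>
    have := (aug_up (ω := ω) (s := s) (k := k) (n := n) (N := N) hn).mul (ih (by omega))
    rw [Nat.factorial_succ]
    exact_mod_cast this

/-- The parameter avoids the poles of the R-matrices `R_i(-i)`, `1 ≤ i < N`. -/
def Generic (N : ℕ) (ω : ℂ) : Prop := ∀ i : ℕ, 1 ≤ i → i < N → ω + 2 * ((i : ℂ) - 1) ≠ 0

theorem Generic.sub_ne_zero (hω : Generic N ω) {i : ℕ} (h1 : 1 ≤ i) (h2 : i < N) :
    -(i : ℂ) - (ω / 2 - 1) ≠ 0 := fun h => hω i h1 h2 (by linear_combination -2 * h)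

namespace IsBrauerFamily

variable (h : IsBrauerFamily N ω s k) (hω : Generic N ω)
include h

theorem commute_rMat {i l : ℕ} (h1 : 1 ≤ i) (h2 : i + 1 < l) (h3 : l < N) (u v : ℂ) :
    Commute (rMat ω (s i) (k i) u) (rMat ω (s l) (k l) v) := by
  rw [rMat_eq (h.ss i h1 (by omega)) (h.sk i h1 (by omega)),
    rMat_eq (h.ss l (by omega) h3) (h.sk l (by omega) h3)]
  have hs : Commute (s i) (rMat ω (s l) (k l) v) := by
    rw [rMat_eq (h.ss l (by omega) h3) (h.sk l (by omega) h3)]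
    exact (((h.far_ss i l h1 h2 h3).sub_right ((Commute.one_right _).smul_right _)).add_right
      ((h.far_sk i l h1 h2 h3).smul_right _))
  have hk : Commute (k i) (rMat ω (s l) (k l) v) := by
    rw [rMat_eq (h.ss l (by omega) h3) (h.sk l (by omega) h3)]
    exact (((h.far_ks i l h1 h2 h3).sub_right ((Commute.one_right _).smul_right _)).add_right
      ((h.far_kk i l h1 h2 h3).smul_right _))
  rw [rMat_eq (h.ss l (by omega) h3) (h.sk l (by omega) h3)] at hs hk
  exact (hs.sub_left ((Commute.one_left _).smul_left _)).add_left (hk.smul_left _)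

include hω

/-- Here `R_i(-1) = 1 + s i - (2 / ω) k i`, twice the symmetrizer on two strands. -/
theorem rMat_neg_one_mul {i : ℕ} (h1 : 1 ≤ i) (h2 : i < N) :
    rMat ω (s i) (k i) (-1) * s i = rMat ω (s i) (k i) (-1) ∧
      rMat ω (s i) (k i) (-1) * k i = 0 := by
  have h0 : ω ≠ 0 := by simpa using hω 1 le_rfl (by omega)
  rw [rMat_eq (h.ss i h1 h2) (h.sk i h1 h2)]
  simp only [add_mul, sub_mul, smul_mul_assoc, h.ss i h1 h2, h.sk i h1 h2, h.ks i h1 h2,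
    h.kk i h1 h2, one_mul]
  constructor
  · module
  · have : (-1 - (ω / 2 - 1)) = -ω / 2 := by ring
    rw [this]
    match_scalars
    field_simp
    ring

/-- An R-matrix `R_i(-1)` can be moved through `down n`. -/
theorem exists_rMat_mul_down {i n : ℕ} (h1 : 1 ≤ i) (h2 : i + 1 ≤ n) (h3 : n < N) :
    ∃ z, rMat ω (s i) (k i) (-1) * down ω s k n = z * rMat ω (s (i + 1)) (k (i + 1)) (-1) := by
  induction n, h2 using Nat.le_induction with
  | base =>
    obtain ⟨i, rfl⟩ : ∃ m, i = m + 1 := ⟨i - 1, by omega⟩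
    have hc : Commute (rMat ω (s (i + 1 + 1)) (k (i + 1 + 1)) (-1)) (down ω s k i) :=
      commute_prodDown fun l h4 h5 =>
        (h.commute_rMat h4 (by omega) (by omega) _ _).symm
    -- The spectral parameters `-1` and `-(i + 1)` add up to `-(i + 2)`, exactly the parameter of
    -- the next factor of `down`.
    have hyb := h.yangBaxter (i := i + 1) (by omega) (by omega) (u := -1)
      (v := -((i + 1 : ℕ) : ℂ)) (by simp) (by rw [neg_ne_zero]; exact_mod_cast i.succ_ne_zero)
      (by rw [← neg_add, neg_ne_zero, add_comm]; exact_mod_cast (i + 1).succ_ne_zero)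
      (by simpa using hω.sub_ne_zero (i := 1) (by omega) (by omega))
      (hω.sub_ne_zero (by omega) (by omega))
      (by
        have := hω.sub_ne_zero (i := i + 1 + 1) (by omega) (by omega)
        convert this using 2
        push_cast; ring)
    rw [show (-1 + -((i + 1 : ℕ) : ℂ)) = -((i + 1 + 1 : ℕ) : ℂ) by push_cast; ring] at hyb
    refine ⟨rMat ω (s (i + 1 + 1)) (k (i + 1 + 1)) (-((i + 1 : ℕ) : ℂ)) *
      rMat ω (s (i + 1)) (k (i + 1)) (-((i + 1 + 1 : ℕ) : ℂ)) * down ω s k i, ?_⟩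
    rw [down, prodDown_succ (by omega), prodDown_succ (by omega), ← mul_assoc, ← mul_assoc, hyb,
      mul_assoc _ (down ω s k i), ← hc.eq, ← mul_assoc]
    rfl
  | succ n hn ih =>
    obtain ⟨z, hz⟩ := ih (by omega)
    -- The new leftmost factor of `down (n + 1)` is far from `R_i` and commutes with it.
    refine ⟨rMat ω (s (n + 1)) (k (n + 1)) (-((n + 1 : ℕ) : ℂ)) * z, ?_⟩
    rw [down, prodDown_succ (by omega), ← mul_assoc,
      (h.commute_rMat h1 (by omega) (by omega) _ _).eq, mul_assoc, mul_assoc]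
    exact congrArg _ hz

theorem rInv_mul_down {n : ℕ} (hn : n < N) {x : A} (hx : RInv n s k x) :
    RInv (n + 1) s k (x * down ω s k n) := by
  -- It suffices to exhibit `R_i(-1)` as a right factor for every `i`. For `i = 1` it is the last
  -- factor of `down n`; otherwise it is created on the left of `down n`, since `x * R_{i-1}(-1) = 2
  -- x`, and carried across. This accounts for the `1 / 2` in the witness.
  have key : ∀ i, 1 ≤ i → i < n + 1 →
      ∃ z, x * down ω s k n = z * rMat ω (s i) (k i) (-1) := by
    intro i h1 h2
    rcases Nat.lt_or_ge 1 i with h4 | h4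
    · obtain ⟨i, rfl⟩ : ∃ m, i = m + 1 := ⟨i - 1, by omega⟩
      obtain ⟨z, hz⟩ := h.exists_rMat_mul_down hω (i := i) (n := n) (by omega) (by omega) hn
      have hx' := (Aug.rMat (s := s) (k := k) (ω := ω) (i := i) (N := n) (by omega) (by omega)
        (-1)).1 x hx
      refine ⟨(1 / 2 : ℂ) • (x * z), ?_⟩
      rw [smul_mul_assoc, mul_assoc, ← hz, ← mul_assoc, hx', smul_mul_assoc, smul_smul]
      norm_num
    · obtain rfl : i = 1 := by omega
      refine ⟨x * prodDown n (1 + 1) (fun i => rMat ω (s i) (k i) (-(i : ℂ))), ?_⟩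
      rw [down, prodDown_cons (by omega), mul_assoc]
      simp
  intro i h1 h2
  obtain ⟨z, hz⟩ := key i h1 h2
  have := h.rMat_neg_one_mul hω h1 (by omega)
  rw [hz, mul_assoc, mul_assoc, this.1, this.2, mul_zero]
  exact ⟨rfl, rfl⟩

theorem rInv_fusionR {n : ℕ} (hn : n ≤ N) : RInv n s k (fusionR ω s k n) := by
  induction n with
  | zero => intro i h1 h2; omega
  | succ n ih => exact h.rInv_mul_down hω hn (ih (by omega))

theorem lInv_fusionL {n : ℕ} (hn : n ≤ N) : LInv n s k (fusionL ω s k n) := by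
  refine lInv_of_op ?_
  rw [op_fusionL h hn]
  exact h.op.rInv_fusionR hω hn

/-- Only the generators of index below `n` enter, so invariance and augmentation are taken at level
`n` rather than `N`; this also covers the smaller factor in the recurrence. -/
theorem fusionR_eq_fusionL {n : ℕ} (hn : n ≤ N) : fusionR ω s k n = fusionL ω s k n :=
  (aug_fusionR le_rfl).eq_of_inv (aug_fusionL le_rfl)
    (by exact_mod_cast n.factorial_ne_zero) (h.rInv_fusionR hω hn) (h.lInv_fusionL hω hn)

end IsBrauerFamily

end Brauer
end

/-! ### Jucys-Murphy elements and the symmetrizer product -/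

noncomputable section

namespace Brauer

variable {A : Type*} [Ring A]

/-- The Jucys-Murphy elements, by the recursion `y_{m+1} = s_m y_m s_m + s_m - k_m`. -/
def jm (s k : ℕ → A) : ℕ → A
  | 0 => 0
  | 1 => 0
  | m + 2 => s (m + 1) * jm s k (m + 1) * s (m + 1) + s (m + 1) - k (m + 1)

theorem jm_succ {s k : ℕ → A} {m : ℕ} (hm : 1 ≤ m) :
    jm s k (m + 1) = s m * jm s k m * s m + s m - k m := by
  obtain ⟨m, rfl⟩ : ∃ n, m = n + 1 := ⟨m - 1, by omega⟩
  rfl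

theorem RInv.mul_of_commute {N : ℕ} {s k : ℕ → A} {x z : A} (hx : RInv N s k x)
    (hz : ∀ i, 1 ≤ i → i < N → Commute (s i) z ∧ Commute (k i) z) : RInv N s k (x * z) :=
  fun i h1 h2 => by
    rw [mul_assoc, ← (hz i h1 h2).1.eq, ← mul_assoc, (hx i h1 h2).1, mul_assoc,
      ← (hz i h1 h2).2.eq, ← mul_assoc, (hx i h1 h2).2, zero_mul]
    exact ⟨rfl, rfl⟩

variable [Algebra ℂ A]

theorem aug_jm {N : ℕ} {s k : ℕ → A} {m : ℕ} (h1 : 1 ≤ m) (h2 : m ≤ N) :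
    Aug N s k (jm s k m) (m - 1) := by
  induction m, h1 using Nat.le_induction with
  | base => simpa [jm] using Aug.algebraMap (N := N) (s := s) (k := k) 0
  | succ m hm ih =>
    rw [jm_succ hm]
    have hs := Aug.gen_s (s := s) (k := k) hm h2
    have := (((hs.mul (ih (by omega))).mul hs).add hs).sub (Aug.gen_k hm h2)
    convert this using 1
    push_cast; ring

/-- The product of `(y_m + 1) (y_m + ω + m - 3)` over `2 ≤ m ≤ n`, with all first factors on the
left. -/
def jmProd (ω : ℂ) (s k : ℕ → A) (n : ℕ) : A :=
  prodUp 2 n (fun m => jm s k m + 1) *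
    prodUp 2 n (fun m => jm s k m + algebraMap ℂ A (ω + m - 3))

theorem aug_jmProd {N : ℕ} {ω : ℂ} {s k : ℕ → A} {n : ℕ} (hn : n ≤ N) :
    Aug N s k (jmProd ω s k n) (n.factorial * ∏ m ∈ Finset.Icc 2 n, (ω + 2 * (m : ℂ) - 4)) := by
  have hf : (n.factorial : ℂ) = ∏ m ∈ Finset.Icc 2 n, (((m : ℂ) - 1) + 1) := by
    clear hn
    induction n with
    | zero => simp
    | succ n ih =>
      rcases Nat.eq_zero_or_pos n with rfl | hn
      · simp
      · rw [Finset.prod_Icc_succ_top (by omega), ← ih, Nat.factorial_succ]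
        push_cast; ring
  rw [hf]
  refine Aug.mul (Aug.prodUp fun m h1 h2 => (aug_jm (by omega) (by omega)).add Aug.one) ?_
  refine Aug.prodUp fun m h1 h2 => ?_
  convert (aug_jm (s := s) (k := k) (N := N) (m := m) (by omega) (by omega)).add
    (Aug.algebraMap (ω + m - 3)) using 1
  ring

namespace IsBrauerFamily

variable {N : ℕ} {ω : ℂ} {s k : ℕ → A} (h : IsBrauerFamily N ω s k)
include h

theorem commute_jm_of_le {i m : ℕ} (h1 : 1 ≤ m) (h2 : m ≤ i) (h3 : i + 1 < N) :
    Commute (s (i + 1)) (jm s k m) ∧ Commute (k (i + 1)) (jm s k m) := by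
  induction m, h1 using Nat.le_induction with
  | base => simp [jm]
  | succ m hm ih =>
    obtain ⟨ihs, ihk⟩ := ih (by omega)
    have e1 := (h.far_ss m (i + 1) hm (by omega) h3).symm
    have e2 := (h.far_ks m (i + 1) hm (by omega) h3).symm
    have e3 := (h.far_sk m (i + 1) hm (by omega) h3).symm
    have e4 := (h.far_kk m (i + 1) hm (by omega) h3).symm
    rw [jm_succ hm]
    exact ⟨(((e1.mul_right ihs).mul_right e1).add_right e1).sub_right e2,
      (((e3.mul_right ihk).mul_right e3).add_right e3).sub_right e4⟩

/-- The relation between the Jucys-Murphy elements and the last contraction. -/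
theorem jm_succ_mul_k {m : ℕ} (h1 : 1 ≤ m) (h2 : m < N) :
    s m * jm s k m * k m = -(jm s k m * k m) := by
  induction m, h1 using Nat.le_induction with
  | base => simp [jm]
  | succ m hm ih =>
    have ih := ih (by omega)
    obtain ⟨cs, -⟩ := h.commute_jm_of_le hm le_rfl h2
    rw [jm_succ hm]
    have hss := h.ss (m + 1) (by omega) h2
    -- This rewriting produces a `k m` to which the induction hypothesis applies, once `s (m + 1)`
    -- has been moved across `jm s k m`.
    have e : s m * k (m + 1) = s (m + 1) * (k m * k (m + 1)) := by
      rw [← mul_assoc, h.skk' m hm h2]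
    have e1 : s (m + 1) * (s m * jm s k m * s m) * k (m + 1)
        = -(s m * jm s k m * s m * k (m + 1)) := by
      calc s (m + 1) * (s m * jm s k m * s m) * k (m + 1)
          = s (m + 1) * s m * jm s k m * (s m * k (m + 1)) := by simp only [mul_assoc]
        _ = s (m + 1) * s m * (jm s k m * s (m + 1)) * (k m * k (m + 1)) := by
            rw [e]; simp only [mul_assoc]
        _ = s (m + 1) * s m * s (m + 1) * jm s k m * k m * k (m + 1) := by
            rw [← cs.eq]; simp only [mul_assoc]
        _ = s m * s (m + 1) * (s m * jm s k m * k m) * k (m + 1) := by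
            rw [← h.braid m hm h2]; simp only [mul_assoc]
        _ = -(s m * (s (m + 1) * jm s k m) * (k m * k (m + 1))) := by
            rw [ih]; simp only [mul_assoc, mul_neg, neg_mul]
        _ = -(s m * jm s k m * (s (m + 1) * (k m * k (m + 1)))) := by
            rw [cs.eq]; simp only [mul_assoc]
        _ = _ := by rw [← e]; simp only [mul_assoc]
    have e2 := h.ssk' hm h2
    have e3 := h.skk' m hm h2
    rw [mul_sub, mul_add, sub_mul, add_mul, sub_mul, add_mul, e1, e2, e3]
    abel

/-- Equivalent to `(y_{m+1} + y_m) k_m = (1 - ω) k_m`: next to a contraction `y_{m+1}` can be traded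
for `y_m`. -/
theorem jm_add_mul_k {m : ℕ} (h1 : 1 ≤ m) (h2 : m < N) (c : ℂ) :
    (jm s k (m + 1) + algebraMap ℂ A c) * k m
      = (algebraMap ℂ A (c + 1 - ω) - jm s k m) * k m := by
  rw [jm_succ h1]
  simp only [add_mul, sub_mul, h.sk m h1 h2, h.kk m h1 h2, mul_assoc _ (s m) (k m),
    h.jm_succ_mul_k h1 h2, ← Algebra.smul_def]
  module

theorem s_mul_jm_succ {m : ℕ} (h1 : 1 ≤ m) (h2 : m < N) :
    jm s k (m + 1) * s m = s m * jm s k m + 1 - k m := by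
  rw [jm_succ h1]
  simp only [add_mul, sub_mul, h.ss m h1 h2, h.ks m h1 h2, mul_assoc _ (s m) (s m), mul_one]

/-- The local case is `m = i + 1`: two steps of the recursion express `y_{i+2}` through `y_i`, which
commutes with `s (i + 1)` and `k (i + 1)`. For larger `m` the added generators are far from `i`. -/
theorem commute_jm {i m : ℕ} (h1 : 1 ≤ i) (h2 : i < m) (h3 : m < N) :
    Commute (s i) (jm s k (m + 1)) ∧ Commute (k i) (jm s k (m + 1)) := by
  induction m, (show i + 1 ≤ m from h2) using Nat.le_induction with
  | base =>
    obtain ⟨cs, ck⟩ := h.commute_jm_of_le h1 le_rfl h3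
    have h3' : i < N := by omega
    have e : jm s k (i + 1 + 1) = s (i + 1) * s i * jm s k i * s i * s (i + 1)
        + s (i + 1) * s i * s (i + 1) - s (i + 1) * k i * s (i + 1) + s (i + 1) - k (i + 1) := by
      rw [jm_succ (by omega), jm_succ h1]
      simp only [mul_add, mul_sub, add_mul, sub_mul, mul_assoc]
    have a := h.ss i h1 h3'
    have f1 : s i * (s (i + 1) * s i * jm s k i * s i * s (i + 1))
        = s (i + 1) * s i * jm s k i * s i * s (i + 1) * s i := by
      calc _ = (s i * s (i + 1) * s i) * jm s k i * s i * s (i + 1) := by simp only [mul_assoc]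
        _ = s (i + 1) * s i * (s (i + 1) * jm s k i) * s i * s (i + 1) := by
            rw [h.braid i h1 h3]; simp only [mul_assoc]
        _ = s (i + 1) * s i * jm s k i * (s (i + 1) * s i * s (i + 1)) := by
            rw [cs.eq]; simp only [mul_assoc]
        _ = _ := by rw [← h.braid i h1 h3]; simp only [mul_assoc]
    have f2 : k i * (s (i + 1) * s i * jm s k i * s i * s (i + 1))
        = s (i + 1) * s i * jm s k i * s i * s (i + 1) * k i := by
      calc _ = (k i * s (i + 1) * s i) * jm s k i * s i * s (i + 1) := by simp only [mul_assoc]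
        _ = k i * (k (i + 1) * jm s k i) * s i * s (i + 1) := by
            rw [h.kss h1 h3]; simp only [mul_assoc]
        _ = k i * jm s k i * (k (i + 1) * s i * s (i + 1)) := by
            rw [ck.eq]; simp only [mul_assoc]
        _ = k i * (jm s k i * k (i + 1)) * k i := by rw [h.kss' h1 h3]; simp only [mul_assoc]
        _ = k i * k (i + 1) * jm s k i * k i := by rw [← ck.eq]; simp only [mul_assoc]
        _ = s (i + 1) * s i * (k (i + 1) * jm s k i) * k i := by
            rw [← h.ssk' h1 h3]; simp only [mul_assoc]
        _ = s (i + 1) * s i * jm s k i * (k (i + 1) * k i) := by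
            rw [ck.eq]; simp only [mul_assoc]
        _ = _ := by rw [← h.ssk h1 h3]; simp only [mul_assoc]
    have sks := h.sks h1 h3
    rw [e]
    constructor
    · rw [Commute, SemiconjBy]
      have g1 : s i * (s (i + 1) * s i * s (i + 1)) = s (i + 1) * s i := by
        rw [← h.braid i h1 h3, ← mul_assoc, ← mul_assoc, a, one_mul]
      have g2 : s (i + 1) * s i * s (i + 1) * s i = s i * s (i + 1) := by
        rw [← h.braid i h1 h3, mul_assoc, a, mul_one]
      have g3 : s i * (s (i + 1) * k i * s (i + 1)) = k (i + 1) * s i := by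
        rw [sks, ← mul_assoc, ← mul_assoc, a, one_mul]
      have g4 : s (i + 1) * k i * s (i + 1) * s i = s i * k (i + 1) := by
        rw [sks, mul_assoc, a, mul_one]
      simp only [mul_add, mul_sub, add_mul, sub_mul, f1, g1, g2, g3, g4]
      abel
    · rw [Commute, SemiconjBy]
      have g1 : k i * (s (i + 1) * s i * s (i + 1)) = k i * k (i + 1) * s (i + 1) := by
        rw [← mul_assoc, ← mul_assoc, h.kss h1 h3]
      have g1' : k i * k (i + 1) * s (i + 1) = k i * k (i + 1) := by
        rw [mul_assoc, h.ks (i + 1) (by omega) h3]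
      have g2 : s (i + 1) * s i * s (i + 1) * k i = k (i + 1) * k i := by
        rw [mul_assoc, mul_assoc, ← mul_assoc (s i), h.ssk h1 h3, ← mul_assoc,
          h.sk (i + 1) (by omega) h3]
      have g3 : k i * (s (i + 1) * k i * s (i + 1)) = k i * s (i + 1) := by
        rw [← mul_assoc, ← mul_assoc, h.ksk h1 h3]
      have g4 : s (i + 1) * k i * s (i + 1) * k i = s (i + 1) * k i := by
        rw [mul_assoc, mul_assoc, ← mul_assoc (k i), h.ksk h1 h3]
      simp only [mul_add, mul_sub, add_mul, sub_mul, f2, g1, g1', g2, g3, g4]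
      abel
  | succ m hm ih =>
    obtain ⟨ihs, ihk⟩ := ih (by omega) (by omega)
    have e1 := h.far_ss i (m + 1) h1 (by omega) h3
    have e2 := h.far_ks i (m + 1) h1 (by omega) h3
    have e3 := h.far_sk i (m + 1) h1 (by omega) h3
    have e4 := h.far_kk i (m + 1) h1 (by omega) h3
    rw [jm_succ (by omega)]
    exact ⟨(((e1.mul_right ihs).mul_right e1).add_right e1).sub_right e3,
      (((e2.mul_right ihk).mul_right e2).add_right e2).sub_right e4⟩

theorem commute_jm_jm {i m : ℕ} (h1 : 1 ≤ i) (h2 : i ≤ m) (h3 : m < N) :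
    Commute (jm s k (m + 1)) (jm s k i) := by
  induction i, h1 using Nat.le_induction with
  | base => simp [jm]
  | succ i hi ih =>
    obtain ⟨es, ek⟩ := h.commute_jm hi (by omega) h3
    rw [jm_succ hi]
    exact (((es.symm.mul_right (ih (by omega))).mul_right es.symm).add_right es.symm).sub_right
      ek.symm

/-- Modulo contractions, which `x` kills, both sides are sums over `i < m` of `x` times `(i, m + 1)`
and of `x` times `(m, m + 1)(i, m)`. The latter product is `(i, m)(i, m + 1)`, and `x` absorbs `(i,
m)`. -/
theorem mul_s_mul_jm_mul_s {m : ℕ} (h1 : 1 ≤ m) (h2 : m < N) {x : A} (hx : RInv m s k x)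
    (hk : x * k m = 0) : x * s m * jm s k m * s m = x * s m * jm s k m := by
  induction m, h1 using Nat.le_induction generalizing x with
  | base => simp [jm]
  | succ m hm ih =>
    obtain ⟨cs, -⟩ := h.commute_jm_of_le hm le_rfl h2
    have hss := h.ss (m + 1) (by omega) h2
    obtain ⟨xs, -⟩ := hx m hm (by omega)
    have k0 : x * s (m + 1) * k m = 0 := by
      have : x * s (m + 1) * k m * s (m + 1) = 0 := by
        rw [mul_assoc x, mul_assoc x, h.sks hm h2, ← mul_assoc, ← mul_assoc, xs, hk, zero_mul]
      rw [← mul_one (x * s (m + 1) * k m), ← hss, ← mul_assoc, this, zero_mul]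
    have b : x * s (m + 1) * s m * s (m + 1) = x * s (m + 1) * s m := by
      rw [mul_assoc x, mul_assoc x, ← h.braid m hm h2, ← mul_assoc, ← mul_assoc, xs, mul_assoc]
    -- The induction hypothesis is applied to `x * s (m + 1)`, which kills `k m` by `k0`.
    have ih := ih (by omega) ((hx.mono (Nat.le_succ m)).mul_of_commute fun i h4 h5 =>
      ⟨h.far_ss i (m + 1) h4 (by omega) h2, h.far_ks i (m + 1) h4 (by omega) h2⟩) k0
    have c : x * s (m + 1) * (s m * jm s k m * s m) = x * s (m + 1) * s m * jm s k m := by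
      rw [← mul_assoc, ← mul_assoc, ih]
    have d : x * s (m + 1) * s m * jm s k m * s (m + 1) = x * s (m + 1) * s m * jm s k m := by
      rw [mul_assoc _ (jm s k m), ← cs.eq, ← mul_assoc, b]
    rw [jm_succ hm, mul_sub, mul_add, k0, c, sub_zero, add_mul, d, b]

/-- Both factors commute with the generators of index below `m`, so only `s m` and `k m` need an
argument. -/
theorem rInv_mul_jm {m : ℕ} (h1 : 1 ≤ m) (h2 : m < N) {x : A} (hx : RInv m s k x) :
    RInv (m + 1) s k
      (x * ((jm s k (m + 1) + 1) * (jm s k (m + 1) + algebraMap ℂ A (ω + (m + 1 : ℕ) - 3)))) := by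
  set c : ℂ := ω + (m + 1 : ℕ) - 3 with hc
  have cc (z : A) : Commute z (algebraMap ℂ A c) := (Algebra.commutes c z).symm
  have hcomm : Commute (jm s k (m + 1) + 1) (jm s k (m + 1) + algebraMap ℂ A c) :=
    ((Commute.refl _).add_right (cc _)).add_left (Commute.one_left _)
  have hx' : RInv m s k (x * (jm s k (m + 1) + algebraMap ℂ A c)) :=
    hx.mul_of_commute fun i h3 h4 =>
      ⟨(h.commute_jm h3 h4 h2).1.add_right (cc _), (h.commute_jm h3 h4 h2).2.add_right (cc _)⟩
  -- On `x`, `y_m` acts by `m - 1`, and `c` is the constant for which `c + 1 - ω` equals this value.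
  have hk : x * (jm s k (m + 1) + algebraMap ℂ A c) * k m = 0 := by
    rw [mul_assoc, h.jm_add_mul_k h1 h2, ← mul_assoc, mul_sub, (aug_jm h1 le_rfl).1 x hx,
      ← Algebra.commutes, ← Algebra.smul_def, hc, ← sub_smul]
    rw [show ω + (m + 1 : ℕ) - 3 + 1 - ω - ((m : ℂ) - 1) = 0 by push_cast; ring]
    simp
  rw [hcomm.eq, ← mul_assoc]
  intro i h3 h4
  rcases Nat.lt_or_ge i m with h5 | h5
  · exact hx'.mul_of_commute (fun i h3 h4 =>
      ⟨(h.commute_jm h3 h4 h2).1.add_right (Commute.one_right _),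
        (h.commute_jm h3 h4 h2).2.add_right (Commute.one_right _)⟩) i h3 h5
  · obtain rfl : i = m := by omega
    constructor
    · have := h.mul_s_mul_jm_mul_s h3 h2 hx' hk
      set z := x * (jm s k (i + 1) + algebraMap ℂ A c)
      rw [mul_assoc, add_mul, h.s_mul_jm_succ h3 h2, jm_succ h3, one_mul]
      simp only [mul_add, mul_sub, ← mul_assoc, this, hk, mul_one]
      abel
    · have e : (jm s k (i + 1) + 1) * k i = (algebraMap ℂ A (1 + 1 - ω) - jm s k i) * k i := by
        simpa using h.jm_add_mul_k h3 h2 1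
      rw [mul_assoc, e, ← mul_assoc, mul_sub, (aug_jm h3 le_rfl).1 _ hx', ← Algebra.commutes,
        ← Algebra.smul_def, ← sub_smul, smul_mul_assoc, hk, smul_zero]

theorem rInv_jmProd {n : ℕ} (hn : n ≤ N) : RInv n s k (jmProd ω s k n) := by
  induction n with
  | zero => intro i h1 h2; omega
  | succ n ih =>
    rcases Nat.eq_zero_or_pos n with rfl | h1
    · intro i h1 h2; omega
    convert h.rInv_mul_jm h1 hn (ih (by omega)) using 1
    rw [jmProd, jmProd, prodUp_succ (by omega), prodUp_succ (by omega)]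
    have : Commute (jm s k (n + 1) + 1)
        (prodUp 2 n fun m => jm s k m + algebraMap ℂ A (ω + m - 3)) :=
      commute_prodUp fun i h3 h4 =>
        ((h.commute_jm_jm (by omega) h4 hn).add_left (Commute.one_left _)).add_right
          ((Algebra.commutes _ _).symm : Commute _ _)
    rw [mul_assoc, ← mul_assoc _ _ (_ + algebraMap ℂ A _), this.eq]
    simp only [mul_assoc]

end IsBrauerFamily
end Brauer
end

/-! ### The factorized form by reflection of indices -/

noncomputable section

namespace Brauer

variable {A : Type*} [Ring A] [Algebra ℂ A]

/-- The factorized form of the fusion product, via the reflection of the indices. -/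
theorem prodUp_prodDown_eq_fusionL {N : ℕ} (hN : 1 ≤ N) (ω : ℂ) (s k : ℕ → A) :
    prodUp 1 (N - 1) (fun a => prodDown (N - 1) a
      (fun l => rMat ω (s l) (k l) ((l : ℂ) - (N : ℂ)))) =
    fusionL ω (fun i => s (N - i)) (fun i => k (N - i)) N := by
  have key : ∀ n, fusionL ω (fun i => s (N - i)) (fun i => k (N - i)) (n + 1)
      = prodDown n 1 (fun a => up ω (fun i => s (N - i)) (fun i => k (N - i)) a) := by
    intro n
    induction n with
    | zero => simp [fusionL, up, prodUp, prodDown]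
    | succ n ih => rw [fusionL, ih, prodDown_succ (by omega)]
  obtain ⟨n, rfl⟩ : ∃ n, N = n + 1 := ⟨N - 1, by omega⟩
  rw [key, prodUp_reflect (n + 1) 1 _ (by omega) le_rfl]
  simp only [Nat.add_sub_cancel, Nat.add_sub_cancel_left]
  refine prodDown_congr fun a h1 h2 => ?_
  rw [prodDown_reflect (n + 1) _ _ (by omega) (by omega), Nat.add_sub_cancel_left,
    show n + 1 - (n + 1 - a) = a by omega, up]
  refine prodUp_congr fun i h3 h4 => ?_
  congr 1
  rw [Nat.cast_sub (by omega)]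
  ring

namespace IsBrauerFamily

variable {N : ℕ} {ω : ℂ} {s k : ℕ → A} (h : IsBrauerFamily N ω s k)
include h

/-- The reflected family has the same set of generators, hence the same invariants and the same
augmentation. -/
theorem fusionR_eq_fusionL_reflect (hω : Generic N ω) :
    fusionR ω s k N = fusionL ω (fun i => s (N - i)) (fun i => k (N - i)) N := by
  have hinv : LInv N s k (fusionL ω (fun i => s (N - i)) (fun i => k (N - i)) N) := by
    intro i h1 h2
    have := h.reflect.lInv_fusionL hω le_rfl (N - i) (by omega) (by omega)
    beta_reduce at this
    rwa [show N - (N - i) = i by omega] at this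
  have haug : Aug N s k (fusionL ω (fun i => s (N - i)) (fun i => k (N - i)) N) N.factorial := by
    have := aug_fusionL (ω := ω) (s := fun i => s (N - i)) (k := fun i => k (N - i)) (le_refl N)
    refine ⟨fun z hz => this.1 z fun i h1 h2 => hz _ (by omega) (by omega),
      fun z hz => this.2 z fun i h1 h2 => hz _ (by omega) (by omega)⟩
  exact (aug_fusionR le_rfl).eq_of_inv haug (by exact_mod_cast N.factorial_ne_zero)
    (h.rInv_fusionR hω le_rfl) hinv

end IsBrauerFamily

/-! ### Passage to the Brauer algebra given by the presentation -/

theorem isBrauerFamily (j : ℕ) (ω : ℂ) : IsBrauerFamily j ω (σ j ω) (κ j ω) := by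
  have es : ∀ i (h1 : 1 ≤ i) (h2 : i < j), σ j ω i = mk j ω (fs ⟨i, h1, h2⟩) :=
    fun i h1 h2 => dif_pos ⟨h1, h2⟩
  have ek : ∀ i (h1 : 1 ≤ i) (h2 : i < j), κ j ω i = mk j ω (fk ⟨i, h1, h2⟩) :=
    fun i h1 h2 => dif_pos ⟨h1, h2⟩
  have skk : ∀ i, 1 ≤ i → i + 1 < j →
      σ j ω i * κ j ω (i + 1) * κ j ω i = σ j ω (i + 1) * κ j ω i := fun i h1 h2 => by
    rw [es i h1 (by omega), es (i + 1) (by omega) h2, ek i h1 (by omega), ek (i + 1) (by omega) h2]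
    simp only [← map_mul]
    exact mk_rel (Rel.s_k_k _ _ rfl)
  have kks : ∀ i, 1 ≤ i → i + 1 < j →
      κ j ω (i + 1) * κ j ω i * σ j ω (i + 1) = κ j ω (i + 1) * σ j ω i := fun i h1 h2 => by
    rw [es i h1 (by omega), es (i + 1) (by omega) h2, ek i h1 (by omega), ek (i + 1) (by omega) h2]
    simp only [← map_mul]
    exact mk_rel (Rel.k_k_s _ _ rfl)
  have kkk : ∀ i, 1 ≤ i → i + 1 < j →
      κ j ω i * κ j ω (i + 1) * κ j ω i = κ j ω i := fun i h1 h2 => by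
    rw [ek i h1 (by omega), ek (i + 1) (by omega) h2]
    simp only [← map_mul]
    exact mk_rel (Rel.k_k_k _ _ rfl)
  have kkk' : ∀ i, 1 ≤ i → i + 1 < j →
      κ j ω (i + 1) * κ j ω i * κ j ω (i + 1) = κ j ω (i + 1) := fun i h1 h2 => by
    rw [ek i h1 (by omega), ek (i + 1) (by omega) h2]
    simp only [← map_mul]
    exact mk_rel (Rel.k_k_k' _ _ rfl)
  exact {
    ss := fun i h1 h2 => by
      rw [es i h1 h2, ← map_mul, mk_rel (Rel.s_sq _), map_one]
    kk := fun i h1 h2 => by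
      rw [ek i h1 h2, ← map_mul, mk_rel (Rel.k_sq _), map_smul]
    sk := fun i h1 h2 => by
      rw [es i h1 h2, ek i h1 h2, ← map_mul, mk_rel (Rel.s_k _)]
    ks := fun i h1 h2 => by
      rw [es i h1 h2, ek i h1 h2, ← map_mul, mk_rel (Rel.k_s _)]
    far_ss := fun i l h1 h2 h3 => by
      rw [es i h1 (by omega), es l (by omega) h3, Commute, SemiconjBy, ← map_mul,
        mk_rel (Rel.s_s_far _ _ (Or.inl h2)), map_mul]
    far_kk := fun i l h1 h2 h3 => by
      rw [ek i h1 (by omega), ek l (by omega) h3, Commute, SemiconjBy, ← map_mul,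
        mk_rel (Rel.k_k_far _ _ (Or.inl h2)), map_mul]
    far_sk := fun i l h1 h2 h3 => by
      rw [es i h1 (by omega), ek l (by omega) h3, Commute, SemiconjBy, ← map_mul,
        mk_rel (Rel.s_k_far _ _ (Or.inl h2)), map_mul]
    far_ks := fun i l h1 h2 h3 => by
      refine Commute.symm ?_
      rw [ek i h1 (by omega), es l (by omega) h3, Commute, SemiconjBy, ← map_mul,
        mk_rel (Rel.s_k_far _ _ (Or.inr h2)), map_mul]
    braid := fun i h1 h2 => by
      rw [es i h1 (by omega), es (i + 1) (by omega) h2]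
      simp only [← map_mul]
      exact mk_rel (Rel.braid _ _ rfl)
    kkk := kkk
    kkk' := kkk'
    skk := skk
    -- The presentation has only half of the mixed relations; the mirror images follow by
    -- multiplying with a contraction and using `kkk'` or `kkk`.
    skk' := fun i h1 h2 => by
      rw [← skk i h1 h2, mul_assoc, mul_assoc, ← mul_assoc (κ j ω (i + 1)), kkk' i h1 h2]
    kks := kks
    kks' := fun i h1 h2 => by
      rw [mul_assoc, ← kks i h1 h2, ← mul_assoc, ← mul_assoc, kkk i h1 h2] }

theorem emb_mk {m n : ℕ} (h : m ≤ n) (ω : ℂ) (x : FreeAlgebra ℂ (Gen m)) :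
    emb h ω (mk m ω x) = FreeAlgebra.lift ℂ (genEmb h ω) x :=
  RingQuot.liftAlgHom_mkAlgHom_apply ℂ _ _ _

theorem emb_σ {m n : ℕ} (h : m ≤ n) (ω : ℂ) {i : ℕ} (h1 : 1 ≤ i) (h2 : i < m) :
    emb h ω (σ m ω i) = σ n ω i := by
  rw [σ, σ, dif_pos ⟨h1, h2⟩, dif_pos ⟨h1, by omega⟩, emb_mk, lift_fs]
  rfl

theorem emb_κ {m n : ℕ} (h : m ≤ n) (ω : ℂ) {i : ℕ} (h1 : 1 ≤ i) (h2 : i < m) :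
    emb h ω (κ m ω i) = κ n ω i := by
  rw [κ, κ, dif_pos ⟨h1, h2⟩, dif_pos ⟨h1, by omega⟩, emb_mk, lift_fk]
  rfl

theorem emb_fusionR {m n a : ℕ} (h : m ≤ n) (ω : ℂ) (ha : a ≤ m) :
    emb h ω (fusionR ω (σ m ω) (κ m ω) a) = fusionR ω (σ n ω) (κ n ω) a := by
  induction a with
  | zero => simp [fusionR]
  | succ a ih =>
    rw [fusionR, fusionR, map_mul, ih (by omega), down, down]
    congr 1
    refine (map_prodDown (emb h ω) _ _ _).trans (prodDown_congr fun i h1 h2 => ?_)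
    simp [rMat, emb_σ h ω h1 (by omega : i < m), emb_κ h ω h1 (by omega : i < m)]

/-- The indices match because `down 0` is an empty product. Injectivity of `emb` plays no role: it
sends generators to generators. -/
theorem Ξ_eq_fusionR (ω : ℂ) (j : ℕ) : Ξ ω j = fusionR ω (σ j ω) (κ j ω) j := by
  induction j using Nat.twoStepInduction with
  | zero => rfl
  | one => simp [Ξ, fusionR, down, prodDown]
  | more j _ ih =>
    rw [Ξ, ih, emb_fusionR _ ω le_rfl]
    rfl

theorem y_eq_jm (j : ℕ) (ω : ℂ) {m : ℕ} (h1 : 1 ≤ m) : y j ω m = jm (σ j ω) (κ j ω) m := by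
  induction m, h1 using Nat.le_induction with
  | base => simp [y, jm]
  | succ m hm ih =>
    obtain ⟨m, rfl⟩ : ∃ n, m = n + 1 := ⟨m - 1, by omega⟩
    rw [jm_succ hm, ← ih, y, y]
    simp only [Nat.add_sub_cancel]
    rw [Finset.sum_Icc_succ_top (by omega), add_sub_assoc, Finset.mul_sum, Finset.sum_mul]
    congr 1
    · refine Finset.sum_congr rfl fun i hi => ?_
      rw [Finset.mem_Icc] at hi
      simp only [σ₂, κ₂, Nat.add_sub_cancel]
      rw [prodUp_succ (by omega), prodDown_succ (by omega)]
      simp only [mul_assoc, mul_sub, sub_mul]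
    · simp [σ₂, κ₂, prodUp, prodDown]

theorem symmetrizer_eq (j : ℕ) (ω : ℂ) :
    symmetrizer j ω = ((1 / (j.factorial : ℂ)) * (1 / ∏ m ∈ Finset.Icc 2 j, (ω + 2 * (m : ℂ) - 4))) •
      jmProd ω (σ j ω) (κ j ω) j := by
  rw [symmetrizer, smul_mul_smul_comm, jmProd]
  congr 2 <;> refine prodUp_congr fun i h1 h2 => ?_ <;> rw [y_eq_jm j ω (by omega)]

end Brauer

end

/-! ### Assembly of the four claims -/

theorem mainTheorem3 (j : ℕ) (hj : 1 ≤ j) (ω : ℝ)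
    (hω : ∀ i : ℕ, 1 ≤ i → i ≤ j - 1 → ω + 2 * ((i : ℝ) - 1) ≠ 0) :
    -- the two forms of the recurrence agree
    (2 ≤ j →
      Brauer.Ξ ω j = Brauer.emb (Nat.sub_le j 1) ω (Brauer.Ξ ω (j - 1)) *
        Brauer.prodDown (j - 1) 1 (fun i => Brauer.RHat j ω i (-(i : ℂ))) ∧
      Brauer.Ξ ω j = Brauer.prodUp 1 (j - 1) (fun i => Brauer.RHat j ω i (-(i : ℂ))) *
        Brauer.emb (Nat.sub_le j 1) ω (Brauer.Ξ ω (j - 1))) ∧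
    -- the factorized form
    Brauer.Ξ ω j = Brauer.prodUp 1 (j - 1) (fun k =>
      Brauer.prodDown (j - 1) k (fun l => Brauer.RHat j ω l ((l : ℂ) - (j : ℂ)))) ∧
    -- the symmetrizer conditions
    (∀ r : ℕ, 1 ≤ r → r ≤ j - 1 →
      Brauer.σ j ω r * Brauer.Ξ ω j = Brauer.Ξ ω j ∧
      Brauer.Ξ ω j * Brauer.σ j ω r = Brauer.Ξ ω j ∧
      Brauer.κ j ω r * Brauer.Ξ ω j = 0 ∧
      Brauer.Ξ ω j * Brauer.κ j ω r = 0) ∧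
    -- normalization, and the identification of the complete symmetrizer
    Brauer.Ξ ω j * Brauer.Ξ ω j = (j.factorial : ℂ) • Brauer.Ξ ω j ∧
    Brauer.symmetrizer j ω = (1 / (j.factorial : ℂ)) • Brauer.Ξ ω j := by
  have hg : Brauer.Generic j (ω : ℂ) := fun i h1 h2 => by exact_mod_cast hω i h1 (by omega)
  have hf := Brauer.isBrauerFamily j (ω : ℂ)
  have hfac : (j.factorial : ℂ) ≠ 0 := by exact_mod_cast j.factorial_ne_zero
  have hΞ := Brauer.Ξ_eq_fusionR (ω : ℂ) j
  have hr : Brauer.RInv j (Brauer.σ j ω) (Brauer.κ j ω) (Brauer.Ξ (ω : ℂ) j) :=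
    hΞ ▸ hf.rInv_fusionR hg le_rfl
  have hl : Brauer.LInv j (Brauer.σ j ω) (Brauer.κ j ω) (Brauer.Ξ (ω : ℂ) j) := by
    rw [hΞ, hf.fusionR_eq_fusionL hg le_rfl]
    exact hf.lInv_fusionL hg le_rfl
  have ha : Brauer.Aug j (Brauer.σ j ω) (Brauer.κ j ω) (Brauer.Ξ (ω : ℂ) j) j.factorial :=
    hΞ ▸ Brauer.aug_fusionR le_rfl
  refine ⟨fun h2 => ?_, ?_, fun r h1 h2 => ?_, ha.1 _ hr, ?_⟩
  · rw [hΞ, Brauer.Ξ_eq_fusionR _ (j - 1), Brauer.emb_fusionR _ _ le_rfl]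
    constructor
    · obtain ⟨n, rfl⟩ : ∃ n, j = n + 1 := ⟨j - 1, by omega⟩
      rfl
    · rw [hf.fusionR_eq_fusionL hg le_rfl, hf.fusionR_eq_fusionL hg (Nat.sub_le j 1)]
      clear hr hl ha hΞ
      obtain ⟨n, rfl⟩ : ∃ n, j = n + 1 := ⟨j - 1, by omega⟩
      rfl
  · rw [hΞ, hf.fusionR_eq_fusionL_reflect hg]
    exact (Brauer.prodUp_prodDown_eq_fusionL hj _ _ _).symm
  · have hr := hr r h1 (by omega)
    have hl := hl r h1 (by omega)
    exact ⟨hl.1, hr.1, hl.2, hr.2⟩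
  · have hp : ∏ m ∈ Finset.Icc 2 j, ((ω : ℂ) + 2 * (m : ℂ) - 4) ≠ 0 :=
      Finset.prod_ne_zero_iff.2 fun m hm h0 => by
        rw [Finset.mem_Icc] at hm
        refine hg (m - 1) (by omega) (by omega) ?_
        rw [Nat.cast_sub (by omega)]
        push_cast
        linear_combination h0
    rw [Brauer.symmetrizer_eq]
    -- The product `jmProd * Ξ` is computed twice: through the augmentation of `jmProd` on the left
    -- invariant `Ξ`, and through that of `Ξ` on the right invariant `jmProd`.
    have hA := (Brauer.aug_jmProd (ω := (ω : ℂ)) (s := Brauer.σ j ω) (k := Brauer.κ j ω)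
      (le_refl j)).2 _ hl
    rw [ha.1 _ (hf.rInv_jmProd le_rfl)] at hA
    rw [← inv_smul_smul₀ hfac (Brauer.jmProd _ _ _ _), hA, smul_smul, smul_smul]
    congr 1
    field_simp
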